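/- Theorem 1.1. Let $\mathbb K$ be $\mathbb R$ or $\mathbb C$; all spaces are over $\mathbb K$ and all maps are linear. Consider the game in which two players, Eve and Odd, alternately choose finite-dimensional normed spaces $E_0\subseteq E_1\subseteq E_2\subseteq\cdots$, where Eve chooses the spaces with even index, Odd chooses those with odd index, the norm of $E_{n+1}$ restricted to $E_n$ is the norm of $E_n$ for every $n$, and there are no further rules. The result of a play is the completion of $\bigcup_{n} E_n$. A strategy of Odd is a rule that assigns to every finite chain $E_0\subseteq\cdots\subseteq E_{2k}$ a finite-dimensional normed space $E_{2k+1}\supseteq E_{2k}$; it leads to a Banach space $G$ if the result of every play in which Odd uses it, no matter how Eve plays, is linearly isometric to $G$. There exists a separable Banach space $G$, unique up to linear isometry among separable Banach spaces, such that Odd has a strategy leading to $G$. Furthermore, $G$ is the Gurarii space, that is, the separable Banach space, unique up to linear isometry, with the following property: for every $\varepsilon>0$ and all finite-dimensional normed spaces $A\subseteq B$ (with the norm of $A$ induced from $B$), every isometric embedding $e\colon A\to G$ has an extension $f\colon B\to G$ such that $(1-\varepsilon)\|x\|\le\|f(x)\|\le(1+\varepsilon)\|x\|$ for every $x\in B$.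 -/

import Mathlib

universe u w

/-- A finite-dimensional normed space over `𝕜` (automatically a Banach space): the possible moves
of the game. -/
structure FinDimNormedSpace (𝕜 : Type) [RCLike 𝕜] : Type (u + 1) where
  /-- the underlying set -/
  carrier : Type u
  [normed : NormedAddCommGroup carrier]
  [space : NormedSpace 𝕜 carrier]
  [finDim : FiniteDimensional 𝕜 carrier]

namespace BanachMazur

variable {𝕜 : Type} [RCLike 𝕜]

instance : CoeSort (FinDimNormedSpace.{u} 𝕜) (Type u) := ⟨FinDimNormedSpace.carrier⟩

instance (E : FinDimNormedSpace.{u} 𝕜) : NormedAddCommGroup E := E.normed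

instance (E : FinDimNormedSpace.{u} 𝕜) : NormedSpace 𝕜 E := E.space

instance (E : FinDimNormedSpace.{u} 𝕜) : FiniteDimensional 𝕜 E := E.finDim

/-- A legal move from `E`: a finite-dimensional normed space containing `E`, the containment being
recorded by the (linear isometric) inclusion map. -/
structure Extension (E : FinDimNormedSpace.{u} 𝕜) where
  /-- the larger space -/
  space : FinDimNormedSpace.{u} 𝕜
  /-- the inclusion of `E` in it -/
  incl : E →ₗᵢ[𝕜] space

/-- A position of the game, that is, a finite chain `E₀ ⊆ E₁ ⊆ ⋯ ⊆ Eₙ` of finite-dimensional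
normed spaces; `Position E` is the type of those whose last term is `E`. -/
inductive Position : FinDimNormedSpace.{u} 𝕜 → Type (u + 1)
  | start (E : FinDimNormedSpace.{u} 𝕜) : Position E
  | move {E : FinDimNormedSpace.{u} 𝕜} (p : Position E) (m : Extension E) : Position m.space

variable (𝕜) in
/-- A strategy: a rule that answers every position, that is, the whole history of the play up to
now, with a legal move. Odd's strategies are consulted only when it is Odd's turn. -/
def Strategy : Type (u + 1) :=
  ∀ E : FinDimNormedSpace.{u} 𝕜, Position E → Extension E

variable (𝕜) in
/-- A chain `E₀ ⊆ E₁ ⊆ E₂ ⊆ ⋯` of finite-dimensional normed spaces, that is, a complete play of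
the game. The spaces with even index are chosen by Eve, those with odd index by Odd. -/
structure Chain : Type (u + 1) where
  /-- the `n`-th space -/
  space : ℕ → FinDimNormedSpace.{u} 𝕜
  /-- the inclusion of the `n`-th space in the next one -/
  incl : ∀ n, space n →ₗᵢ[𝕜] space (n + 1)

namespace Chain

variable (C : Chain.{u} 𝕜)

/-- The `(n + 1)`-st term of the chain as a move from the `n`-th term. -/
def step (n : ℕ) : Extension (C.space n) := ⟨C.space (n + 1), C.incl n⟩

/-- The position `E₀ ⊆ ⋯ ⊆ Eₙ` reached in the play. -/
def position : ∀ n, Position (C.space n)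
  | 0 => Position.start (C.space 0)
  | n + 1 => Position.move (position n) (C.step n)

/-- The play is one in which Odd uses the strategy `S`: whenever Eve has just chosen `E₂ₖ`, the
next space (with the inclusion map) is the answer of `S` to the history so far. -/
def OddFollows (S : Strategy.{u} 𝕜) : Prop :=
  ∀ k : ℕ, C.step (2 * k) = S (C.space (2 * k)) (C.position (2 * k))

/-- The inclusion of `Eₘ` in `Eₙ` for `m ≤ n`. -/
def inclLE (m n : ℕ) (h : m ≤ n) : C.space m →ₗᵢ[𝕜] C.space n :=
  Nat.leRec (motive := fun n _ => C.space m →ₗᵢ[𝕜] C.space n) LinearIsometry.id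
    (fun k _ f => (C.incl k).comp f) h

theorem inclLE_self (m : ℕ) : C.inclLE m m le_rfl = LinearIsometry.id := by
  simp [inclLE]

theorem inclLE_succ (m n : ℕ) (h : m ≤ n) :
    C.inclLE m (n + 1) (h.trans n.le_succ) = (C.incl n).comp (C.inclLE m n h) := by
  simp [inclLE, Nat.leRec_succ _ _ h]

instance : DirectedSystem (fun n => C.space n) (fun i j h => C.inclLE i j h) where
  map_self i x := by simp [inclLE_self]
  map_map k j i hij hjk x := by
    induction k, hjk using Nat.le_induction with
    | base => simp [inclLE_self]
    | succ n hn ih =>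
      rw [inclLE_succ C j n hn, inclLE_succ C i n (hij.trans hn)]
      simp [ih]

/-- The union `⋃ₙ Eₙ` of the chain, as a vector space: the direct limit of the inclusions. -/
def Union : Type u := DirectLimit (fun n => C.space n) C.inclLE

noncomputable section

instance : AddCommGroup C.Union :=
  inferInstanceAs (AddCommGroup (DirectLimit (fun n => C.space n) C.inclLE))

instance : Module 𝕜 C.Union :=
  inferInstanceAs (Module 𝕜 (DirectLimit (fun n => C.space n) C.inclLE))

/-- The norm of the union: it restricts to the norm of `Eₙ` for every `n`. -/
instance : Norm C.Union where
  norm := DirectLimit.lift C.inclLE (fun _ x => ‖x‖) fun i j h x => ((C.inclLE i j h).norm_map x).symm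

theorem normedSpaceCore : NormedSpace.Core 𝕜 C.Union where
  norm_nonneg x := by
    induction x using DirectLimit.induction with
    | ih i x => exact norm_nonneg x
  norm_smul c x := by
    induction x using DirectLimit.induction with
    | ih i x => exact norm_smul c x
  norm_triangle x y := by
    induction x, y using DirectLimit.induction₂ with
    | ih i x y =>
      have h := DirectLimit.add_def (f := C.inclLE) i x y
      exact (congrArg (fun z : C.Union => ‖z‖) h).trans_le (norm_add_le x y)
  norm_eq_zero_iff x := by
    induction x using DirectLimit.induction with
    | ih i x =>
      have h := DirectLimit.zero_def (f := C.inclLE) i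
      constructor
      · intro hx
        have hx' : x = 0 := norm_eq_zero.mp hx
        rw [hx']
        exact h.symm
      · intro hx
        have h2 := congrArg (fun z : C.Union => ‖z‖) (hx.trans h)
        exact h2.trans (norm_zero (E := C.space i))

instance : NormedAddCommGroup C.Union := NormedAddCommGroup.ofCore C.normedSpaceCore

instance : NormedSpace 𝕜 C.Union := NormedSpace.ofCore C.normedSpaceCore

/-- The result of the play: the completion of the union of the chain. -/
abbrev Result : Type u := UniformSpace.Completion C.Union

end

end Chain

variable (𝕜) in
/-- Odd has a strategy leading to `G`: however Eve plays, if Odd uses the strategy then the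
completion of the union of the resulting chain is linearly isometric to `G`. -/
def OddHasStrategyLeadingTo (G : Type w) [NormedAddCommGroup G] [NormedSpace 𝕜 G] : Prop :=
  ∃ S : Strategy.{u} 𝕜, ∀ C : Chain.{u} 𝕜, C.OddFollows S → Nonempty (C.Result ≃ₗᵢ[𝕜] G)

variable (𝕜) in
/-- The extension property defining the Gurarii space among the separable Banach spaces: for every
`ε > 0` and finite-dimensional normed spaces `A ⊆ B`, every linear isometric embedding `A → G`
extends to a linear `ε`-isometric embedding `B → G`. -/
def IsGurarii (G : Type w) [NormedAddCommGroup G] [NormedSpace 𝕜 G] : Prop :=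
  ∀ ε : ℝ, 0 < ε → ∀ (B : FinDimNormedSpace.{u} 𝕜) (A : Submodule 𝕜 B) (e : A →ₗᵢ[𝕜] G),
    ∃ f : B →ₗ[𝕜] G, (∀ x : A, f x = e x) ∧
      ∀ x : B, (1 - ε) * ‖x‖ ≤ ‖f x‖ ∧ ‖f x‖ ≤ (1 + ε) * ‖x‖

end BanachMazur

namespace BanachMazur

variable {𝕜 : Type} [RCLike 𝕜]

/-! A Gurarii space is built by bookkeeping. Extensions of `E` by `d` dimensions correspond to norms
on `E × 𝕜ᵈ`, which form a separable family for the uniform distance on a ball; hence countably many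
of them suffice up to small distortion (`exists_dense_extensions`). Amalgamating these one at a time
along a chain yields `exists_rich_chain`, and a perturbation argument shows that the completed union
is Gurarii (`Chain.isGurarii_result`).

Against a Gurarii space `G` either player can force the result to be `G`. The play is shadowed by
almost isometries `Eₙ → G` whose distortions and successive distances decay geometrically. Any move
can be followed, and a player choosing the move can also put a prescribed vector in the range of the
next map (`IsGurarii.exists_absorbing`). The maps converge to isometric embeddings of the chain, and
absorbing a dense sequence makes the union of their ranges dense
(`IsGurarii.nonempty_result_equiv`).

For uniqueness, Odd plays a strategy leading to `G'` while Eve absorbs `G`: the result is isometric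
to both (`IsGurarii.nonempty_equiv`). Another separable Gurarii Banach space also gives Odd a
strategy, so it is covered by the same argument. -/

/-- A linear map that distorts the norm by a factor between `1 - ε` and `1 + ε`. -/
def IsAlmostIsometry {E F : Type*} [NormedAddCommGroup E] [NormedSpace 𝕜 E]
    [NormedAddCommGroup F] [NormedSpace 𝕜 F] (ε : ℝ) (f : E →ₗ[𝕜] F) : Prop :=
  ∀ x, (1 - ε) * ‖x‖ ≤ ‖f x‖ ∧ ‖f x‖ ≤ (1 + ε) * ‖x‖

/-! ### Amalgamation of finite-dimensional normed spaces -/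

section Pushout

variable {A X Y : Type u}
  [NormedAddCommGroup X] [NormedSpace 𝕜 X] [FiniteDimensional 𝕜 X]
  [NormedAddCommGroup Y] [NormedSpace 𝕜 Y] [FiniteDimensional 𝕜 Y]

/-- The pushout of two linear maps between finite-dimensional normed spaces: the quotient of the
`ℓ¹`-sum by the antidiagonal copy of the common domain. -/
theorem exists_pushout [AddCommGroup A] [Module 𝕜 A] (u : A →ₗ[𝕜] X) (v : A →ₗ[𝕜] Y) :
    ∃ (W : FinDimNormedSpace.{u} 𝕜) (i : X →ₗ[𝕜] W) (k : Y →ₗ[𝕜] W),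
      (∀ a, i (u a) = k (v a)) ∧ (∀ x, ‖i x‖ ≤ ‖x‖) ∧ (∀ y, ‖k y‖ ≤ ‖y‖) ∧
      ∀ x y c, (∀ a, c ≤ ‖x + u a‖ + ‖y - v a‖) → c ≤ ‖i x + k y‖ := by
  let e : (X × Y) ≃ₗ[𝕜] WithLp 1 (X × Y) := (WithLp.linearEquiv 1 𝕜 (X × Y)).symm
  have norm_e (p : X × Y) : ‖e p‖ = ‖p.1‖ + ‖p.2‖ := WithLp.prod_norm_eq_of_L1 _
  have : FiniteDimensional 𝕜 (WithLp 1 (X × Y)) := Module.Finite.equiv e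
  let S : Submodule 𝕜 (WithLp 1 (X × Y)) := LinearMap.range (e.toLinearMap ∘ₗ (u.prod (-v)))
  have : IsClosed (S : Set (WithLp 1 (X × Y))) := S.closed_of_finiteDimensional
  let i : X →ₗ[𝕜] WithLp 1 (X × Y) ⧸ S := S.mkQ ∘ₗ e.toLinearMap ∘ₗ LinearMap.inl 𝕜 X Y
  let k : Y →ₗ[𝕜] WithLp 1 (X × Y) ⧸ S := S.mkQ ∘ₗ e.toLinearMap ∘ₗ LinearMap.inr 𝕜 X Y
  refine ⟨⟨WithLp 1 (X × Y) ⧸ S⟩, i, k, fun a => ?_, fun x => ?_, fun y => ?_, fun x y c h => ?_⟩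
  · refine (Submodule.Quotient.eq S).2 ⟨a, ?_⟩
    simp [← map_sub]
  · refine (Submodule.Quotient.norm_mk_le _ _).trans_eq ?_
    simp [norm_e]
  · refine (Submodule.Quotient.norm_mk_le _ _).trans_eq ?_
    simp [norm_e]
  · refine le_of_forall_pos_lt_add fun η hη => ?_
    -- The quotient norm is an infimum over representatives, and those of the class of `(x, y)` are
    -- the pairs `(x + u a, y - v a)`.
    obtain ⟨m, hm, hlt⟩ := Submodule.Quotient.norm_mk_lt (S := S) (i x + k y) hη
    have hxy : i x + k y = Submodule.Quotient.mk (e (x, y)) := by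
      change S.mkQ (e (x, 0)) + S.mkQ (e (0, y)) = S.mkQ (e (x, y))
      rw [← map_add, ← map_add, Prod.mk_add_mk, add_zero, zero_add]
    rw [hxy, Submodule.Quotient.eq] at hm
    obtain ⟨a, ha⟩ := hm
    have hm' : m = e (x + u a, y - v a) := by
      rw [eq_sub_iff_add_eq] at ha
      rw [← ha]
      simp only [LinearMap.comp_apply, LinearEquiv.coe_coe, ← map_add]
      congr 1
      ext <;> simp [add_comm, sub_eq_add_neg]
    rw [hm', norm_e] at hlt
    exact (h a).trans_lt hlt

/-- Amalgamation of an isometric embedding with a contraction bounded below. -/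
theorem exists_amalgam [NormedAddCommGroup A] [NormedSpace 𝕜 A] (u : A →ₗ[𝕜] X) (v : A →ₗᵢ[𝕜] Y)
    {c : ℝ} (hc : c ≤ 1) (hu : ∀ a, c * ‖a‖ ≤ ‖u a‖ ∧ ‖u a‖ ≤ ‖a‖) :
    ∃ (W : FinDimNormedSpace.{u} 𝕜) (i : X →ₗᵢ[𝕜] W) (k : Y →ₗ[𝕜] W),
      (∀ a, k (v a) = i (u a)) ∧ ∀ y, c * ‖y‖ ≤ ‖k y‖ ∧ ‖k y‖ ≤ ‖y‖ := by
  obtain ⟨W, i, k, h, hi, hk, hc'⟩ := exists_pushout u v.toLinearMap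
  refine ⟨W, ⟨i, fun x => (hi x).antisymm ?_⟩, k, fun a => (h a).symm, fun y => ⟨?_, hk y⟩⟩
  · have := hc' x 0 ‖x‖ fun a => by
      have := norm_sub_le (x + u a) (u a)
      simp only [add_sub_cancel_right] at this
      simpa using this.trans (add_le_add le_rfl (hu a).2)
    simpa using this
  · have := hc' 0 y (c * ‖y‖) fun a => by
      have h1 : ‖y‖ ≤ ‖y - v a‖ + ‖a‖ := by
        simpa using norm_add_le (y - v a) (v a)
      have h2 := (hu a).1
      have h3 := norm_nonneg (y - v a)
      have h4 := norm_nonneg a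
      simp only [zero_add, LinearIsometry.coe_toLinearMap]
      -- For `0 ≤ c` multiply the triangle inequality by `c ≤ 1`; for `c < 0` the left side is
      -- nonpositive.
      rcases le_or_gt 0 c with hc0 | hc0
      · nlinarith
      · nlinarith [norm_nonneg y, norm_nonneg (u a)]
    simpa using this

/-- An almost isometry between finite-dimensional spaces is close to an inclusion in a common
superspace, which moreover may be taken over a given superspace of the domain. -/
theorem exists_almost_amalgam [NormedAddCommGroup A] [NormedSpace 𝕜 A] [FiniteDimensional 𝕜 A]
    (m : A →ₗᵢ[𝕜] X) {f : A →ₗ[𝕜] Y} {δ : ℝ} (hδ : 0 ≤ δ) (hf : IsAlmostIsometry δ f) :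
    ∃ (W : FinDimNormedSpace.{u} 𝕜) (i : X →ₗᵢ[𝕜] W) (j : Y →ₗᵢ[𝕜] W),
      ∀ a, ‖i (m a) - j (f a)‖ ≤ δ * ‖a‖ := by
  let e : (X × Y) ≃ₗ[𝕜] WithLp 1 (X × Y) := (WithLp.linearEquiv 1 𝕜 (X × Y)).symm
  have norm_e (p : X × Y) : ‖e p‖ = ‖p.1‖ + ‖p.2‖ := WithLp.prod_norm_eq_of_L1 _
  have : FiniteDimensional 𝕜 (WithLp 1 (X × Y)) := Module.Finite.equiv e
  have norm_δ (a : A) : ‖(δ : 𝕜) • a‖ = δ * ‖a‖ := by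
    rw [norm_smul, RCLike.norm_ofReal, abs_of_nonneg hδ]
  -- Identifying `(m a, -f a)` with `δ • a` in a third summand `A` caps the distance between `m a`
  -- and `f a` at `δ * ‖a‖`. The distortion bound on `f` is exactly what keeps the norms of `X` and
  -- `Y` from shrinking.
  obtain ⟨W, i, k, h, hi, hk, hc⟩ := exists_pushout
    (e.toLinearMap ∘ₗ (m.toLinearMap.prod (-f))) ((δ : 𝕜) • (LinearMap.id : A →ₗ[𝕜] A))
  have key (p : X × Y) (c : ℝ) (hp : ∀ a, c ≤ ‖p.1 + m a‖ + ‖p.2 - f a‖ + δ * ‖a‖) :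
      c ≤ ‖i (e p)‖ := by
    have := hc (e p) 0 c fun a => by
      have h1 : e p + e (m a, -f a) = e (p.1 + m a, p.2 - f a) := by
        rw [← map_add]; simp [sub_eq_add_neg, Prod.add_def]
      have h2 := hp a
      change c ≤ ‖e p + e (m a, -f a)‖ + ‖0 - (δ : 𝕜) • a‖
      rwa [h1, norm_e, zero_sub, norm_neg, norm_δ]
    simpa using this
  refine ⟨W, ⟨i ∘ₗ e.toLinearMap ∘ₗ LinearMap.inl 𝕜 X Y, fun x => le_antisymm ?_ ?_⟩,
    ⟨i ∘ₗ e.toLinearMap ∘ₗ LinearMap.inr 𝕜 X Y, fun y => le_antisymm ?_ ?_⟩, fun a => ?_⟩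
  · exact (hi _).trans_eq (by simp [norm_e])
  · refine key (x, 0) ‖x‖ fun a => ?_
    have h1 : ‖x‖ ≤ ‖x + m a‖ + ‖a‖ := by simpa using norm_sub_le (x + m a) (m a)
    have h2 := (hf a).1
    simp only [zero_sub, norm_neg]
    linarith
  · exact (hi _).trans_eq (by simp [norm_e])
  · refine key (0, y) ‖y‖ fun a => ?_
    have h1 : ‖y‖ ≤ ‖y - f a‖ + ‖f a‖ := by simpa using norm_add_le (y - f a) (f a)
    have h2 := (hf a).2
    simp only [zero_add, m.norm_map]
    linarith
  · have h1 : i (e (m a, 0)) - i (e (0, f a)) = k ((δ : 𝕜) • a) := by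
      rw [← map_sub, ← map_sub]
      simpa using h a
    exact (congrArg norm h1).trans_le ((hk _).trans_eq (norm_δ a))

end Pushout

/-! ### The union of a chain -/

namespace Chain

variable (C : Chain.{u} 𝕜)

/-- The inclusion of `Eₙ` in the union of the chain. -/
def toUnion (n : ℕ) : C.space n →ₗᵢ[𝕜] C.Union where
  toFun x := (⟦⟨n, x⟩⟧ : DirectLimit (fun n => C.space n) C.inclLE)
  map_add' x y := (DirectLimit.add_def (f := C.inclLE) n x y).symm
  map_smul' c x := (DirectLimit.smul_def (f := C.inclLE) n x c).symm
  norm_map' _ := rfl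

theorem exists_toUnion_eq (z : C.Union) : ∃ n x, C.toUnion n x = z := by
  induction z using DirectLimit.induction with
  | ih i x => exact ⟨i, x, rfl⟩

theorem toUnion_inclLE {m n : ℕ} (h : m ≤ n) (x : C.space m) :
    C.toUnion n (C.inclLE m n h x) = C.toUnion m x := by
  have h1 := DirectLimit.mk_apply (F := fun n => C.space n) (f := C.inclLE) m n x h
  exact h1

/-- The inclusion of `Eₙ` in the result of the play. -/
noncomputable def toResult (n : ℕ) : C.space n →ₗᵢ[𝕜] C.Result :=
  UniformSpace.Completion.toComplₗᵢ.comp (C.toUnion n)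

theorem toResult_inclLE {m n : ℕ} (h : m ≤ n) (x : C.space m) :
    C.toResult n (C.inclLE m n h x) = C.toResult m x :=
  congrArg (fun z : C.Union => (z : C.Result)) (C.toUnion_inclLE h x)

theorem exists_norm_sub_toResult_lt (z : C.Result) {ε : ℝ} (hε : 0 < ε) :
    ∃ n x, ‖z - C.toResult n x‖ < ε := by
  obtain ⟨y, hy⟩ := UniformSpace.Completion.denseRange_coe.exists_dist_lt z hε
  obtain ⟨n, x, rfl⟩ := C.exists_toUnion_eq y
  exact ⟨n, x, by rwa [dist_eq_norm] at hy⟩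

instance : TopologicalSpace.SeparableSpace C.Result := by
  have h : (Set.range ((↑) : C.Union → C.Result)) = ⋃ n, Set.range (C.toResult n) := by
    ext z
    simp only [Set.mem_range, Set.mem_iUnion]
    constructor
    · rintro ⟨y, rfl⟩
      obtain ⟨n, x, rfl⟩ := C.exists_toUnion_eq y
      exact ⟨n, x, rfl⟩
    · rintro ⟨n, x, rfl⟩
      exact ⟨C.toUnion n x, rfl⟩
  have hs : TopologicalSpace.IsSeparable (Set.range ((↑) : C.Union → C.Result)) := by
    rw [h]
    refine TopologicalSpace.IsSeparable.iUnion fun n => ?_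
    have := FiniteDimensional.proper_rclike 𝕜 (C.space n)
    exact TopologicalSpace.isSeparable_range (C.toResult n).continuous
  rw [← TopologicalSpace.isSeparable_univ_iff,
    ← (UniformSpace.Completion.denseRange_coe (α := C.Union)).closure_range]
  exact hs.closure

/-- Compatible isometric embeddings of the terms of a chain in a Banach space, with dense union of
the ranges, identify the space with the result of the play. -/
theorem nonempty_result_equiv {G : Type w} [NormedAddCommGroup G] [NormedSpace 𝕜 G]
    [CompleteSpace G] (F : ∀ n, C.space n →ₗᵢ[𝕜] G)
    (hF : ∀ n x, F (n + 1) (C.incl n x) = F n x)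
    (hd : ∀ (z : G) (ε : ℝ), 0 < ε → ∃ n x, ‖z - F n x‖ < ε) :
    Nonempty (C.Result ≃ₗᵢ[𝕜] G) := by
  have hF' (m n : ℕ) (h : m ≤ n) (x : C.space m) : F m x = F n (C.inclLE m n h x) := by
    induction n, h using Nat.le_induction with
    | base => simp [inclLE_self]
    | succ n hn ih => simp [inclLE_succ C m n hn, hF, ih]
  let g : C.Union → G := DirectLimit.lift C.inclLE (fun n x => F n x) hF'
  have hg (n : ℕ) (x : C.space n) : g (C.toUnion n x) = F n x := rfl
  have hadd (x y : C.Union) : g (x + y) = g x + g y := by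
    obtain ⟨m, x, rfl⟩ := C.exists_toUnion_eq x
    obtain ⟨n, y, rfl⟩ := C.exists_toUnion_eq y
    rw [← C.toUnion_inclLE (le_max_left m n), ← C.toUnion_inclLE (le_max_right m n), 
      ← (C.toUnion _).map_add, hg, hg, hg, map_add]
  have hsmul (c : 𝕜) (x : C.Union) : g (c • x) = c • g x := by
    obtain ⟨m, x, rfl⟩ := C.exists_toUnion_eq x
    rw [← (C.toUnion m).map_smul, hg, hg, map_smul]
  let L : C.Union →ₗ[𝕜] G := { toFun := g, map_add' := hadd, map_smul' := hsmul }
  refine ⟨(LinearEquiv.refl 𝕜 C.Union).extendOfIsometry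
    (UniformSpace.Completion.toComplₗᵢ (𝕜 := 𝕜) (E := C.Union)).toLinearMap L
    UniformSpace.Completion.denseRange_coe ?_ fun x => ?_⟩
  · refine Metric.denseRange_iff.2 fun z ε hε => ?_
    obtain ⟨n, x, hx⟩ := hd z ε hε
    exact ⟨C.toUnion n x, by rwa [dist_eq_norm]⟩
  · obtain ⟨m, x, rfl⟩ := C.exists_toUnion_eq x
    have h1 : ‖L (C.toUnion m x)‖ = ‖x‖ := (F m).norm_map x
    simpa using h1

end Chain

/-! ### A chain realizing all finite-dimensional extensions up to small distortion -/

/-- `f` is an almost isometry between two extensions that is the identity on the base space. -/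
def Extension.IsAlmostIsometry {E : FinDimNormedSpace.{u} 𝕜} {j k : Extension E} (ε : ℝ)
    (f : j.space →ₗ[𝕜] k.space) : Prop :=
  (∀ x, f (j.incl x) = k.incl x) ∧ BanachMazur.IsAlmostIsometry ε f

/-- Restricting the transported norms to the compact unit ball puts them in the separable space
`C(K, ℝ)`. Uniformly close norms have a small relative distortion, because `φ.symm` is bounded. All
coordinate maps agree with the inclusion on `E × 0`, so the comparison map fixes `E`. -/
theorem exists_countable_dense_extensions_of_codim (E : FinDimNormedSpace.{u} 𝕜) (d : ℕ) :
    ∃ T : Set (Extension E), T.Countable ∧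
      ∀ (j : Extension E) (φ : (E × (Fin d → 𝕜)) ≃ₗ[𝕜] j.space), (∀ x, φ (x, 0) = j.incl x) →
        ∀ ε : ℝ, 0 < ε → ∃ k ∈ T, ∃ f : j.space →ₗ[𝕜] k.space, Extension.IsAlmostIsometry ε f := by
  have := FiniteDimensional.proper_rclike 𝕜 (E × (Fin d → 𝕜))
  let K := Metric.closedBall (0 : E × (Fin d → 𝕜)) 1
  let J := {p : Σ j : Extension E, (E × (Fin d → 𝕜)) ≃ₗ[𝕜] j.space //
    ∀ x, p.2 (x, 0) = p.1.incl x}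
  let g : J → C(K, ℝ) := fun p => ⟨fun v => ‖p.1.2 v‖,
    ((LinearMap.continuous_of_finiteDimensional p.1.2.toLinearMap).comp
      continuous_subtype_val).norm⟩
  obtain ⟨t, htg, htc, htd⟩ := (TopologicalSpace.IsSeparable.of_separableSpace
    (Set.range g)).exists_countable_dense_subset
  choose s hs using fun y : t => htg y.2
  have : Countable t := htc
  refine ⟨Set.range fun y : t => (s y).1.1, Set.countable_range _, fun j φ hφ ε hε => ?_⟩
  -- The summand `1` keeps `c` positive when the space is trivial.
  let c : ℝ := ‖LinearMap.toContinuousLinearMap φ.symm.toLinearMap‖ + 1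
  have hc0 : 0 < c := by positivity
  have hc (b : j.space) : ‖φ.symm b‖ ≤ c * ‖b‖ := by
    refine ((LinearMap.toContinuousLinearMap φ.symm.toLinearMap).le_opNorm b).trans ?_
    gcongr
    linarith
  obtain ⟨y, hyt, hy⟩ := Metric.mem_closure_iff.1 (htd ⟨⟨⟨j, φ⟩, hφ⟩, rfl⟩) (ε / c) (by positivity)
  let p := s ⟨y, hyt⟩
  have hp : g p = y := hs ⟨y, hyt⟩
  refine ⟨p.1.1, ⟨⟨y, hyt⟩, rfl⟩, p.1.2.toLinearMap ∘ₗ φ.symm.toLinearMap, fun x => ?_, fun b => ?_⟩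
  · have : φ.symm (j.incl x) = (x, 0) := by rw [← hφ, φ.symm_apply_apply]
    simp [this, p.2 x]
  · have hball (v : E × (Fin d → 𝕜)) (hv : ‖v‖ ≤ 1) : |‖φ v‖ - ‖p.1.2 v‖| ≤ ε / c := by
      have h1 := ContinuousMap.dist_apply_le_dist (f := g ⟨⟨j, φ⟩, hφ⟩) (g := y)
        (⟨v, mem_closedBall_zero_iff.2 hv⟩ : K)
      rw [← hp, Real.dist_eq] at h1
      rw [← hp] at hy
      exact h1.trans hy.le
    have hall (v : E × (Fin d → 𝕜)) : |‖φ v‖ - ‖p.1.2 v‖| ≤ ε / c * ‖v‖ := by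
      rcases eq_or_ne v 0 with rfl | hv
      · simp
      have hv' : 0 < ‖v‖ := norm_pos_iff.2 hv
      have h1 := hball (((‖v‖⁻¹ : ℝ) : 𝕜) • v) (by
        rw [norm_smul, RCLike.norm_ofReal, abs_of_pos (by positivity)]
        field_simp; rfl)
      rw [map_smul, map_smul, norm_smul, norm_smul, RCLike.norm_ofReal,
        abs_of_pos (inv_pos.2 hv'), ← mul_sub, abs_mul, abs_of_pos (inv_pos.2 hv')] at h1
      rwa [inv_mul_le_iff₀ hv', mul_comm] at h1
    have h1 := hall (φ.symm b)
    rw [φ.apply_symm_apply] at h1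
    have h2 : ε / c * ‖φ.symm b‖ ≤ ε * ‖b‖ := by
      calc ε / c * ‖φ.symm b‖ ≤ ε / c * (c * ‖b‖) := by gcongr; exact hc b
        _ = ε * ‖b‖ := by field_simp
    have h3 := abs_le.1 (h1.trans h2)
    simp only [LinearMap.comp_apply, LinearEquiv.coe_coe]
    constructor <;> linarith [h3.1, h3.2]

theorem Extension.exists_equiv_prod {E : FinDimNormedSpace.{u} 𝕜} (j : Extension E) :
    ∃ (d : ℕ) (φ : (E × (Fin d → 𝕜)) ≃ₗ[𝕜] j.space), ∀ x, φ (x, 0) = j.incl x := by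
  obtain ⟨Q, hQ⟩ := Submodule.exists_isCompl (LinearMap.range j.incl.toLinearMap)
  refine ⟨_, (LinearEquiv.prodCongr (j.incl.equivRange.toLinearEquiv)
    (Module.finBasis 𝕜 Q).equivFun.symm).trans (Submodule.prodEquivOfIsCompl _ Q hQ), fun x => ?_⟩
  simp

/-- The finite-dimensional extensions of `E` are separable with respect to the distortion of
isomorphisms over `E`. -/
theorem exists_dense_extensions (E : FinDimNormedSpace.{u} 𝕜) :
    ∃ t : ℕ → Extension E, ∀ (j : Extension E) (ε : ℝ), 0 < ε →
      ∃ (i : ℕ) (f : j.space →ₗ[𝕜] (t i).space), Extension.IsAlmostIsometry ε f := by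
  choose T hTc hT using exists_countable_dense_extensions_of_codim E
  have key (j : Extension E) (ε : ℝ) (hε : 0 < ε) : ∃ k ∈ ⋃ d, T d,
      ∃ f : j.space →ₗ[𝕜] k.space, Extension.IsAlmostIsometry ε f := by
    obtain ⟨d, φ, hφ⟩ := j.exists_equiv_prod
    obtain ⟨k, hk, f, hf⟩ := hT d j φ hφ ε hε
    exact ⟨k, Set.mem_iUnion.2 ⟨d, hk⟩, f, hf⟩
  -- Enumerating the countable set by `ℕ` needs it nonempty.
  obtain ⟨k₀, hk₀, -⟩ := key ⟨E, LinearIsometry.id⟩ 1 one_pos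
  obtain ⟨t, ht⟩ := (Set.countable_iUnion hTc).exists_eq_range ⟨k₀, hk₀⟩
  refine ⟨t, fun j ε hε => ?_⟩
  obtain ⟨k, hk, f, hf⟩ := key j ε hε
  rw [ht] at hk
  obtain ⟨i, rfl⟩ := hk
  exact ⟨i, f, hf⟩

theorem Extension.exists_push {E : FinDimNormedSpace.{u} 𝕜} (j m : Extension E) :
    ∃ (p : Extension m.space) (k : j.space →ₗᵢ[𝕜] p.space),
      ∀ x, k (j.incl x) = p.incl (m.incl x) := by
  obtain ⟨W, i, k, h, hk⟩ := exists_amalgam m.incl.toLinearMap j.incl le_rfl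
    fun a => ⟨(by simp), (by simp)⟩
  exact ⟨⟨W, i⟩, ⟨k, fun y => (hk y).2.antisymm (by simpa using (hk y).1)⟩, h⟩

/-- The amalgam of two extensions of `E`, as an extension of the second one. -/
noncomputable def Extension.push {E : FinDimNormedSpace.{u} 𝕜} (j m : Extension E) :
    Extension m.space :=
  (j.exists_push m).choose

/-- A sequence of extensions of `E` that is dense with respect to distortion. -/
noncomputable def denseExtension (E : FinDimNormedSpace.{u} 𝕜) : ℕ → Extension E :=
  (exists_dense_extensions E).choose

variable (𝕜) in
/-- The terms of the chain, each with its list of extensions waiting to be amalgamated: the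
`i`-th extension of the dense sequence of the `n`-th term has number `Nat.pair n i` in the list,
and at stage `t` the extension with number `t` is chosen as the next term. -/
noncomputable def schedule : ℕ → Σ E : FinDimNormedSpace.{u} 𝕜, ℕ → Extension E
  | 0 => ⟨⟨PUnit⟩, fun t => denseExtension _ t.unpair.2⟩
  | n + 1 => ⟨((schedule n).2 n).space, fun t =>
      -- Entries whose first component exceeds `n + 1` are placeholders, overwritten at the stage
      -- which that component names. Since the first component of `t` is at most `t`, this happens
      -- no later than entry `t` is used.
      if t.unpair.1 = n + 1 then denseExtension _ t.unpair.2
      else ((schedule n).2 t).push ((schedule n).2 n)⟩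

variable (𝕜) in
/-- The chain of the scheduled spaces. -/
noncomputable def richChain : Chain.{u} 𝕜 where
  space n := (schedule 𝕜 n).1
  incl n := ((schedule 𝕜 n).2 n).incl

theorem schedule_pair (n i : ℕ) :
    (schedule.{u} 𝕜 n).2 (Nat.pair n i) = denseExtension ((richChain 𝕜).space n) i := by
  cases n with
  | zero => exact congrArg (denseExtension _) (by simp)
  | succ n =>
    refine (if_pos (by simp)).trans ?_
    exact congrArg (denseExtension _) (by simp)

/-- A waiting extension is repeatedly pushed out along the moves made meanwhile; composing the
pushout maps embeds the original extension in its current version. It is not overwritten after stage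
`n`, as its first component is `n`. -/
theorem exists_denseExtension_embedding (n i m : ℕ) (h : n ≤ m) :
    ∃ k : (denseExtension ((richChain.{u} 𝕜).space n) i).space →ₗᵢ[𝕜]
        ((schedule 𝕜 m).2 (Nat.pair n i)).space,
      ∀ x, k ((denseExtension _ i).incl x) =
        ((schedule 𝕜 m).2 (Nat.pair n i)).incl ((richChain 𝕜).inclLE n m h x) := by
  induction m, h using Nat.le_induction with
  | base =>
    rw [schedule_pair]
    exact ⟨LinearIsometry.id, fun x => by rw [Chain.inclLE_self]; rfl⟩
  | succ m hm ih =>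
    obtain ⟨k, hk⟩ := ih
    have h1 : (schedule.{u} 𝕜 (m + 1)).2 (Nat.pair n i) =
        ((schedule 𝕜 m).2 (Nat.pair n i)).push ((schedule 𝕜 m).2 m) :=
      if_neg (by simp; omega)
    rw [h1]
    obtain ⟨k', hk'⟩ := (((schedule 𝕜 m).2 (Nat.pair n i)).exists_push
      ((schedule 𝕜 m).2 m)).choose_spec
    refine ⟨k'.comp k, fun x => ?_⟩
    rw [Chain.inclLE_succ _ n m hm]
    exact (congrArg k' (hk x)).trans (hk' _)

variable (𝕜) in
/-- There is a chain such that every finite-dimensional extension of one of its terms almost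
embeds in a later term over the given one. -/
theorem exists_rich_chain : ∃ C : Chain.{u} 𝕜, ∀ (n : ℕ) (j : Extension (C.space n)) (ε : ℝ),
    0 < ε → ∃ (m : ℕ) (h : n ≤ m) (f : j.space →ₗ[𝕜] C.space m),
      (∀ x, f (j.incl x) = C.inclLE n m h x) ∧ IsAlmostIsometry ε f := by
  refine ⟨richChain 𝕜, fun n j ε hε => ?_⟩
  obtain ⟨i, f, hf, hf'⟩ := (exists_dense_extensions ((richChain 𝕜).space n)).choose_spec j ε hε
  have hn := Nat.left_le_pair n i
  obtain ⟨k, hk⟩ := exists_denseExtension_embedding (𝕜 := 𝕜) n i (Nat.pair n i) hn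
  -- The entry numbered `Nat.pair n i` is chosen at that stage, so it is the term one index later.
  refine ⟨Nat.pair n i + 1, hn.trans (Nat.le_succ _), k.toLinearMap ∘ₗ f, fun x => ?_, fun x => ?_⟩
  · rw [Chain.inclLE_succ _ n _ hn]
    exact (congrArg k (hf x)).trans (hk x)
  · have h1 : ‖(k.toLinearMap ∘ₗ f) x‖ = ‖f x‖ := k.norm_map (f x)
    have h2 := hf' x
    rw [← h1] at h2
    exact h2

/-! ### The extension property of the union of a rich chain -/

/-- Approximate the images of a basis by vectors of one common term; boundedness of the coordinate
functionals makes the error proportional to `‖a‖`. -/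
theorem Chain.exists_approx (C : Chain.{u} 𝕜) {A : Type w} [NormedAddCommGroup A]
    [NormedSpace 𝕜 A] [FiniteDimensional 𝕜 A] (e : A →ₗ[𝕜] C.Result) {δ : ℝ} (hδ : 0 < δ) :
    ∃ (n : ℕ) (e' : A →ₗ[𝕜] C.space n), ∀ a, ‖C.toResult n (e' a) - e a‖ ≤ δ * ‖a‖ := by
  let b := Module.finBasis 𝕜 A
  let M : ℝ := ‖LinearMap.toContinuousLinearMap b.equivFun.toLinearMap‖
  let d : ℝ := Module.finrank 𝕜 A
  have hM (a : A) (i) : ‖b.equivFun a i‖ ≤ M * ‖a‖ :=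
    (norm_le_pi_norm _ i).trans
      ((LinearMap.toContinuousLinearMap b.equivFun.toLinearMap).le_opNorm a)
  have hM0 : 0 ≤ M := norm_nonneg _
  have hd0 : 0 ≤ d := Nat.cast_nonneg _
  choose n x hx using fun i => C.exists_norm_sub_toResult_lt (e (b i))
    (show 0 < δ / (d * M + 1) by positivity)
  let N := Finset.univ.sup n
  have hN (i) : n i ≤ N := Finset.le_sup (Finset.mem_univ i)
  refine ⟨N, b.constr 𝕜 fun i => C.inclLE (n i) N (hN i) (x i), fun a => ?_⟩
  have h1 : C.toResult N ((b.constr 𝕜 fun i => C.inclLE (n i) N (hN i) (x i)) a) - e a =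
      ∑ i, b.equivFun a i • (C.toResult (n i) (x i) - e (b i)) := by
    conv_lhs => rw [← b.sum_equivFun a]
    simp only [map_sum, map_smul, Module.Basis.constr_basis, C.toResult_inclLE, smul_sub,
      Finset.sum_sub_distrib]
  rw [h1]
  calc ‖∑ i, b.equivFun a i • (C.toResult (n i) (x i) - e (b i))‖
      ≤ ∑ i, ‖b.equivFun a i • (C.toResult (n i) (x i) - e (b i))‖ := norm_sum_le _ _
    _ ≤ ∑ _i : Fin (Module.finrank 𝕜 A), M * ‖a‖ * (δ / (d * M + 1)) := by
        refine Finset.sum_le_sum fun i _ => ?_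
        rw [norm_smul, norm_sub_rev]
        gcongr
        · exact hM a i
        · exact (hx i).le
    _ = (d * M) / (d * M + 1) * (δ * ‖a‖) := by
        rw [Finset.sum_const, Finset.card_univ, Fintype.card_fin, nsmul_eq_mul]
        ring
    _ ≤ 1 * (δ * ‖a‖) := by
        gcongr
        rw [div_le_one (by positivity)]
        linarith
    _ = δ * ‖a‖ := one_mul _

/-- Move `e` slightly into one term of the chain, amalgamate that term with `B`, and return to the
chain by richness. The resulting map is almost isometric but only close to `e` on `A`; a small
correction through a projection onto `A` makes it an exact extension. -/
theorem Chain.isGurarii_result (C : Chain.{u} 𝕜)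
    (hC : ∀ (n : ℕ) (j : Extension (C.space n)) (ε : ℝ), 0 < ε →
      ∃ (m : ℕ) (h : n ≤ m) (f : j.space →ₗ[𝕜] C.space m),
        (∀ x, f (j.incl x) = C.inclLE n m h x) ∧ IsAlmostIsometry ε f) :
    IsGurarii.{u} 𝕜 C.Result := by
  intro ε hε B A e
  obtain ⟨P, hP⟩ := LinearMap.exists_leftInverse_of_injective A.subtype A.ker_subtype
  have hP' (a : A) : P a = a := congrArg (fun g : A →ₗ[𝕜] A => g a) hP
  let K : ℝ := ‖LinearMap.toContinuousLinearMap P‖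
  have hK (y : B) : ‖P y‖ ≤ K * ‖y‖ := (LinearMap.toContinuousLinearMap P).le_opNorm y
  have hK0 : 0 ≤ K := norm_nonneg _
  -- Since `(1 + δ)² ≤ 1 + 3δ` and `(1 - δ)² ≥ 1 - 2δ`, and the correction costs at most `δ * K`,
  -- the total error is at most `δ * (3 + K)`.
  obtain ⟨δ, hδ0, hδ1, hδε⟩ : ∃ δ : ℝ, 0 < δ ∧ δ ≤ 1 ∧ δ * (3 + K) ≤ ε := by
    refine ⟨min 1 (ε / (3 + K)), by positivity, min_le_left _ _, ?_⟩
    rw [← le_div_iff₀ (by positivity)]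
    exact min_le_right _ _
  have hδ2 : (0 : ℝ) < 1 + δ := by positivity
  have norm_δ : ‖((1 + δ : ℝ) : 𝕜)‖ = 1 + δ := by
    rw [RCLike.norm_ofReal, abs_of_pos hδ2]
  obtain ⟨n, e', he'⟩ := C.exists_approx e.toLinearMap hδ0
  have he'' (a : A) : (1 - δ) * ‖a‖ ≤ ‖e' a‖ ∧ ‖e' a‖ ≤ (1 + δ) * ‖a‖ := by
    have h1 := abs_le.1 ((abs_norm_sub_norm_le _ _).trans (he' a))
    rw [LinearIsometry.norm_map, LinearIsometry.coe_toLinearMap, LinearIsometry.norm_map] at h1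
    constructor <;> linarith [h1.1, h1.2]
  have hu (a : A) : ‖(((1 + δ : ℝ) : 𝕜)⁻¹ • e') a‖ = (1 + δ)⁻¹ * ‖e' a‖ := by
    rw [LinearMap.smul_apply, norm_smul, norm_inv, norm_δ]
  -- Dividing by `1 + δ` turns `e'` into the contraction that the amalgamation requires; `f₀`
  -- multiplies the factor back.
  obtain ⟨W, i, k, hki, hk⟩ := exists_amalgam (((1 + δ : ℝ) : 𝕜)⁻¹ • e') A.subtypeₗᵢ
    (c := (1 - δ) / (1 + δ)) ((div_le_one hδ2).2 (by linarith)) fun a => by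
      rw [hu]
      constructor
      · rw [div_eq_inv_mul, mul_assoc]
        gcongr
        exact (he'' a).1
      · rw [inv_mul_le_iff₀ hδ2]
        exact (he'' a).2
  obtain ⟨m, hnm, f, hf, hf'⟩ := hC n ⟨W, i⟩ δ hδ0
  let f₀ : B →ₗ[𝕜] C.Result := ((1 + δ : ℝ) : 𝕜) • ((C.toResult m).toLinearMap ∘ₗ f ∘ₗ k)
  have hδ3 : ((1 + δ : ℝ) : 𝕜) ≠ 0 := by
    rw [← norm_ne_zero_iff, norm_δ]
    exact hδ2.ne'
  have hf₀ (a : A) : f₀ a = C.toResult n (e' a) := by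
    have h1 : k a = ((1 + δ : ℝ) : 𝕜)⁻¹ • i (e' a) := (hki a).trans (map_smul _ _ _)
    have h2 : f (i (e' a)) = C.inclLE n m hnm (e' a) := hf (e' a)
    simp only [f₀, LinearMap.smul_apply, LinearMap.comp_apply, h1, map_smul, h2,
      LinearIsometry.coe_toLinearMap, C.toResult_inclLE]
    rw [smul_smul, mul_inv_cancel₀ hδ3, one_smul]
  have hnorm (y : B) : ‖f₀ y‖ = (1 + δ) * ‖f (k y)‖ := by
    simp only [f₀, LinearMap.smul_apply, LinearMap.comp_apply, norm_smul, norm_δ,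
      LinearIsometry.coe_toLinearMap, LinearIsometry.norm_map]
  refine ⟨f₀ + (e.toLinearMap - f₀ ∘ₗ A.subtype) ∘ₗ P, fun a => ?_, fun y => ?_⟩
  · simp [hP']
  · have h1 : ‖((e.toLinearMap - f₀ ∘ₗ A.subtype) ∘ₗ P) y‖ ≤ δ * (K * ‖y‖) := by
      have h2 : ((e.toLinearMap - f₀ ∘ₗ A.subtype) ∘ₗ P) y =
          e.toLinearMap (P y) - C.toResult n (e' (P y)) := by
        rw [← hf₀]; rfl
      rw [h2, norm_sub_rev]
      refine (he' (P y)).trans ?_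
      gcongr
      exact hK y
    have h3 : ‖f₀ y‖ ≤ (1 + δ) * ((1 + δ) * ‖y‖) := by
      rw [hnorm]
      gcongr
      refine (hf' (k y)).2.trans ?_
      gcongr
      exact (hk y).2
    have h4 : (1 - δ) * ((1 - δ) * ‖y‖) ≤ ‖f₀ y‖ := by
      rw [hnorm]
      have h5 : (1 - δ) * ((1 - δ) / (1 + δ) * ‖y‖) ≤ ‖f (k y)‖ := by
        refine le_trans ?_ (hf' (k y)).1
        have : 0 ≤ 1 - δ := by linarith
        gcongr
        exact (hk y).1
      refine le_trans (le_of_eq ?_) (mul_le_mul_of_nonneg_left h5 hδ2.le)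
      field_simp
    have h6 := norm_nonneg y
    have h7 : δ * (3 + K) * ‖y‖ ≤ ε * ‖y‖ := by gcongr
    have h8 : δ * δ * ‖y‖ ≤ δ * ‖y‖ := by
      gcongr
      exact mul_le_of_le_one_left hδ0.le hδ1
    have h9 : 0 ≤ δ * δ * ‖y‖ := by positivity
    have h10 : 0 ≤ δ * ‖y‖ := by positivity
    rw [LinearMap.add_apply]
    constructor
    · have := norm_sub_le (f₀ y + ((e.toLinearMap - f₀ ∘ₗ A.subtype) ∘ₗ P) y)
        (((e.toLinearMap - f₀ ∘ₗ A.subtype) ∘ₗ P) y)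
      rw [add_sub_cancel_right] at this
      nlinarith
    · have := norm_add_le (f₀ y) (((e.toLinearMap - f₀ ∘ₗ A.subtype) ∘ₗ P) y)
      nlinarith

/-! ### Strategies leading to a Gurarii space -/

section Gurarii

variable {G : Type u} [NormedAddCommGroup G] [NormedSpace 𝕜 G]

theorem IsGurarii.exists_extension (hG : IsGurarii.{u} 𝕜 G) {Y : Type u} [NormedAddCommGroup Y]
    [NormedSpace 𝕜 Y] {Z : FinDimNormedSpace.{u} 𝕜} (j : Y →ₗᵢ[𝕜] Z) (e : Y →ₗᵢ[𝕜] G) {ε : ℝ}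
    (hε : 0 < ε) : ∃ f : Z →ₗ[𝕜] G, (∀ y, f (j y) = e y) ∧ IsAlmostIsometry ε f := by
  obtain ⟨f, hf, hf'⟩ := hG ε hε Z (LinearMap.range j.toLinearMap)
    (e.comp j.equivRange.symm.toLinearIsometry)
  refine ⟨f, fun y => (hf ⟨j y, y, rfl⟩).trans (congrArg e ?_), hf'⟩
  exact j.equivRange.symm_apply_apply y

/-- Amalgamate `E'` with the subspace of `G` spanned by the range of `f` and `v`, identifying `m x`
with `f x` up to `δ`, then extend the inclusion of that subspace in `G`. The extension is exact on
the subspace, so `v` is in the range and the error on `E` is at most `(1 + δ') * δ ≤ 2 * δ`. -/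
theorem IsGurarii.exists_absorbing (hG : IsGurarii.{u} 𝕜 G) {E E' : FinDimNormedSpace.{u} 𝕜}
    (m : E →ₗᵢ[𝕜] E') {f : E →ₗ[𝕜] G} {δ δ' : ℝ} (hδ : 0 ≤ δ) (hf : IsAlmostIsometry δ f)
    (hδ' : 0 < δ') (hδ'1 : δ' ≤ 1) (v : G) :
    ∃ (Z : FinDimNormedSpace.{u} 𝕜) (i : E' →ₗᵢ[𝕜] Z) (h : Z →ₗ[𝕜] G), IsAlmostIsometry δ' h ∧
      (∀ x, ‖h (i (m x)) - f x‖ ≤ 2 * δ * ‖x‖) ∧ v ∈ LinearMap.range h := by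
  let Y : Submodule 𝕜 G := LinearMap.range f ⊔ Submodule.span 𝕜 {v}
  let f' : E →ₗ[𝕜] Y := f.codRestrict Y fun x => Submodule.mem_sup_left ⟨x, rfl⟩
  obtain ⟨Z, i, j, hij⟩ := exists_almost_amalgam m hδ (f := f') hf
  obtain ⟨h, hj, hh⟩ := hG.exists_extension j Y.subtypeₗᵢ hδ'
  refine ⟨Z, i, h, hh, fun x => ?_, ?_⟩
  · have h1 : h (i (m x)) - f x = h (i (m x) - j (f' x)) := by
      rw [map_sub, hj]; rfl
    rw [h1]
    calc ‖h (i (m x) - j (f' x))‖ ≤ (1 + δ') * ‖i (m x) - j (f' x)‖ := (hh _).2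
      _ ≤ 2 * (δ * ‖x‖) := by
        gcongr
        · linarith
        · exact hij x
      _ = 2 * δ * ‖x‖ := by ring
  · exact ⟨j ⟨v, Submodule.mem_sup_right (Submodule.mem_span_singleton_self v)⟩, hj _⟩

/-- The number of moves made before a position. -/
def Position.length {E : FinDimNormedSpace.{u} 𝕜} : Position E → ℕ
  | .start _ => 0
  | .move p _ => p.length + 1

theorem Chain.length_position (C : Chain.{u} 𝕜) (n : ℕ) : (C.position n).length = n := by
  induction n with
  | zero => rfl
  | succ n ih => exact congrArg (· + 1) ih

/-- A `2⁻ⁿ⁻²`-almost isometry on an extension of `E` that is `2⁻ⁿ`-close to `f` on `E`. -/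
def IsTracking {E : FinDimNormedSpace.{u} 𝕜} (n : ℕ) (f : E →ₗ[𝕜] G) (m : Extension E)
    (f' : m.space →ₗ[𝕜] G) : Prop :=
  IsAlmostIsometry ((1 / 2) ^ (n + 2)) f' ∧ ∀ x, ‖f' (m.incl x) - f x‖ ≤ (1 / 2) ^ n * ‖x‖

instance (E : FinDimNormedSpace.{u} 𝕜) : Nonempty (Extension E) := ⟨⟨E, LinearIsometry.id⟩⟩

/-- An almost isometric embedding in `G` of the last term of a position, close to the embedding of
the previous term and with the next vector to be absorbed in its range, if possible. -/
noncomputable def tracking (v : ℕ → G) : ∀ {E : FinDimNormedSpace.{u} 𝕜}, Position E → E →ₗ[𝕜] G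
  | _, .start _ => Classical.epsilon (IsAlmostIsometry ((1 / 2) ^ 1))
  | _, .move p m => Classical.epsilon fun f' => IsTracking p.length (tracking v p) m f' ∧
      ((∃ f'', IsTracking p.length (tracking v p) m f'' ∧
        v (p.length / 2).unpair.1 ∈ LinearMap.range f'') →
        v (p.length / 2).unpair.1 ∈ LinearMap.range f')

/-- The strategy of absorbing a sequence of vectors. -/
noncomputable def absorbingStrategy (v : ℕ → G) : Strategy.{u} 𝕜 := fun _ p =>
  Classical.epsilon fun m => ∃ f', IsTracking p.length (tracking v p) m f' ∧
    v (p.length / 2).unpair.1 ∈ LinearMap.range f'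

theorem IsGurarii.exists_isTracking (hG : IsGurarii.{u} 𝕜 G) {E : FinDimNormedSpace.{u} 𝕜}
    {n : ℕ} {f : E →ₗ[𝕜] G} (hf : IsAlmostIsometry ((1 / 2) ^ (n + 1)) f) (m : Extension E) :
    ∃ f', IsTracking n f m f' := by
  -- No vector needs absorbing here, so `0` serves; `2 * (1 / 2) ^ (n + 1)` is the required
  -- closeness.
  obtain ⟨Z, i, h, hh, hclose, -⟩ := hG.exists_absorbing m.incl (by positivity) hf
    (δ' := (1 / 2) ^ (n + 2)) (by positivity) (pow_le_one₀ (by norm_num) (by norm_num)) 0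
  refine ⟨h ∘ₗ i.toLinearMap, fun x => ?_, fun x => ?_⟩
  · simpa using hh (i x)
  · refine (hclose x).trans_eq ?_
    ring

theorem IsGurarii.exists_isTracking_mem_range (hG : IsGurarii.{u} 𝕜 G)
    {E : FinDimNormedSpace.{u} 𝕜} {n : ℕ} {f : E →ₗ[𝕜] G}
    (hf : IsAlmostIsometry ((1 / 2) ^ (n + 1)) f) (v : G) :
    ∃ (m : Extension E) (f' : m.space →ₗ[𝕜] G), IsTracking n f m f' ∧ v ∈ LinearMap.range f' := by
  obtain ⟨Z, i, h, hh, hclose, hv⟩ := hG.exists_absorbing (LinearIsometry.id (E := E))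
    (by positivity) hf (δ' := (1 / 2) ^ (n + 2)) (by positivity)
    (pow_le_one₀ (by norm_num) (by norm_num)) v
  refine ⟨⟨Z, i⟩, h, ⟨hh, fun x => (hclose x).trans_eq ?_⟩, hv⟩
  ring

theorem IsGurarii.isTracking_move_of (hG : IsGurarii.{u} 𝕜 G) (v : ℕ → G)
    {E : FinDimNormedSpace.{u} 𝕜} (p : Position E) (m : Extension E)
    (hp : IsAlmostIsometry ((1 / 2) ^ (p.length + 1)) (tracking v p)) :
    IsTracking p.length (tracking v p) m (tracking v (p.move m)) ∧
      ((∃ f'', IsTracking p.length (tracking v p) m f'' ∧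
        v (p.length / 2).unpair.1 ∈ LinearMap.range f'') →
        v (p.length / 2).unpair.1 ∈ LinearMap.range (tracking v (p.move m))) := by
  have h : tracking v (p.move m) = Classical.epsilon fun f' =>
      IsTracking p.length (tracking v p) m f' ∧
      ((∃ f'', IsTracking p.length (tracking v p) m f'' ∧
        v (p.length / 2).unpair.1 ∈ LinearMap.range f'') →
        v (p.length / 2).unpair.1 ∈ LinearMap.range f') := rfl
  rw [h]
  refine Classical.epsilon_spec (p := fun f' => IsTracking p.length (tracking v p) m f' ∧
    ((∃ f'', IsTracking p.length (tracking v p) m f'' ∧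
      v (p.length / 2).unpair.1 ∈ LinearMap.range f'') →
      v (p.length / 2).unpair.1 ∈ LinearMap.range f')) ?_
  by_cases hv : ∃ f'', IsTracking p.length (tracking v p) m f'' ∧
      v (p.length / 2).unpair.1 ∈ LinearMap.range f''
  · exact hv.imp fun f'' hf'' => ⟨hf''.1, fun _ => hf''.2⟩
  · exact (hG.exists_isTracking hp m).imp fun f' hf' => ⟨hf', fun h => absurd h hv⟩

theorem IsGurarii.isAlmostIsometry_tracking (hG : IsGurarii.{u} 𝕜 G) (v : ℕ → G)
    {E : FinDimNormedSpace.{u} 𝕜} (p : Position E) :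
    IsAlmostIsometry ((1 / 2) ^ (p.length + 1)) (tracking v p) := by
  induction p with
  | start E =>
    refine Classical.epsilon_spec (p := IsAlmostIsometry ((1 / 2) ^ 1)) ?_
    -- The initial almost isometry extends the zero map on the trivial subspace.
    obtain ⟨f, -, hf⟩ := hG ((1 / 2) ^ 1) (by norm_num) E ⊥ ⟨0, fun x => by
      simp [Subsingleton.elim x 0]⟩
    exact ⟨f, hf⟩
  | move p m ih => exact (hG.isTracking_move_of v p m ih).1.1

theorem IsGurarii.isTracking_tracking (hG : IsGurarii.{u} 𝕜 G) (v : ℕ → G)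
    {E : FinDimNormedSpace.{u} 𝕜} (p : Position E) (m : Extension E) :
    IsTracking p.length (tracking v p) m (tracking v (p.move m)) :=
  (hG.isTracking_move_of v p m (hG.isAlmostIsometry_tracking v p)).1

/-- The strategy and `tracking` choose their maps separately. No coordination is needed: the
strategy picks a move for which absorption is possible, and `tracking` absorbs whenever that is
possible. -/
theorem IsGurarii.mem_range_tracking (hG : IsGurarii.{u} 𝕜 G) (v : ℕ → G)
    {E : FinDimNormedSpace.{u} 𝕜} (p : Position E) {m : Extension E}
    (hm : m = absorbingStrategy v E p) :
    v (p.length / 2).unpair.1 ∈ LinearMap.range (tracking v (p.move m)) := by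
  have hp := hG.isAlmostIsometry_tracking v p
  refine (hG.isTracking_move_of v p m hp).2 ?_
  rw [hm]
  exact Classical.epsilon_spec (p := fun m : Extension E => ∃ f',
    IsTracking p.length (tracking v p) m f' ∧ v (p.length / 2).unpair.1 ∈ LinearMap.range f')
    (hG.exists_isTracking_mem_range hp _)

end Gurarii

/-! ### Passage to the limit and winning plays -/

open Filter Topology

theorem Chain.inclLE_incl (C : Chain.{u} 𝕜) {n m : ℕ} (h : n + 1 ≤ m) (x : C.space n) :
    C.inclLE (n + 1) m h (C.incl n x) = C.inclLE n m (n.le_succ.trans h) x := by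
  induction m, h using Nat.le_induction with
  | base => rw [inclLE_self, inclLE_succ C n n le_rfl, inclLE_self]; rfl
  | succ m hm ih =>
    rw [inclLE_succ C (n + 1) m hm, inclLE_succ C n m (n.le_succ.trans hm)]
    exact congrArg (C.incl m) ih

/-- Almost isometries on the terms of a chain, whose distortions and successive distances decay
geometrically, converge to isometric embeddings. -/
theorem Chain.exists_limit_embeddings (C : Chain.{u} 𝕜) {G : Type w} [NormedAddCommGroup G]
    [NormedSpace 𝕜 G] [CompleteSpace G] (f : ∀ n, C.space n →ₗ[𝕜] G)
    (hf : ∀ n, IsAlmostIsometry ((1 / 2) ^ (n + 1)) (f n))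
    (hclose : ∀ n x, ‖f (n + 1) (C.incl n x) - f n x‖ ≤ (1 / 2) ^ n * ‖x‖) :
    ∃ F : ∀ n, C.space n →ₗᵢ[𝕜] G, (∀ n x, F (n + 1) (C.incl n x) = F n x) ∧
      ∀ n x, ‖f n x - F n x‖ ≤ 2 * (1 / 2) ^ n * ‖x‖ := by
  -- The value `0` for `m < n` is a filler; only large `m` matters for the limit.
  let a (n : ℕ) (x : C.space n) (m : ℕ) : G := if h : n ≤ m then f m (C.inclLE n m h x) else 0
  have ha {n m : ℕ} (h : n ≤ m) (x : C.space n) : a n x m = f m (C.inclLE n m h x) := dif_pos h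
  have hstep (n : ℕ) (x : C.space n) (k : ℕ) :
      dist (a n x (k + n)) (a n x (k + 1 + n)) ≤ (1 / 2) ^ n * ‖x‖ * (1 / 2) ^ k := by
    have h : n ≤ k + n := Nat.le_add_left n k
    rw [show k + 1 + n = k + n + 1 by ring, ha h, ha (h.trans (Nat.le_succ _)), dist_comm,
      dist_eq_norm, inclLE_succ C n (k + n) h]
    refine (hclose (k + n) (C.inclLE n (k + n) h x)).trans_eq ?_
    rw [LinearIsometry.norm_map, pow_add]
    ring
  have hlim (n : ℕ) (x : C.space n) : ∃ y, Tendsto (a n x) atTop (𝓝 y) := by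
    obtain ⟨y, hy⟩ := cauchySeq_tendsto_of_complete
      (cauchySeq_of_le_geometric _ _ (by norm_num) (hstep n x))
    exact ⟨y, (tendsto_add_atTop_iff_nat n).1 hy⟩
  choose F hF using hlim
  have hadd (n : ℕ) (x y : C.space n) : F n (x + y) = F n x + F n y := by
    refine tendsto_nhds_unique (hF n (x + y)) (((hF n x).add (hF n y)).congr' ?_)
    filter_upwards [eventually_ge_atTop n] with m hm
    simp only [ha hm, map_add]
  have hsmul (n : ℕ) (c : 𝕜) (x : C.space n) : F n (c • x) = c • F n x := by
    refine tendsto_nhds_unique (hF n (c • x)) (((hF n x).const_smul c).congr' ?_)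
    filter_upwards [eventually_ge_atTop n] with m hm
    simp only [ha hm, map_smul]
  have hpow : Tendsto (fun m : ℕ => ((1 : ℝ) / 2) ^ (m + 1)) atTop (𝓝 0) :=
    (tendsto_add_atTop_iff_nat 1).2
      (tendsto_pow_atTop_nhds_zero_of_lt_one (by norm_num) (by norm_num))
  have hnorm (n : ℕ) (x : C.space n) : ‖F n x‖ = ‖x‖ := by
    refine tendsto_nhds_unique (hF n x).norm ?_
    refine tendsto_of_tendsto_of_tendsto_of_le_of_le'
      (g := fun m : ℕ => (1 - (1 / 2) ^ (m + 1)) * ‖x‖)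
      (h := fun m : ℕ => (1 + (1 / 2) ^ (m + 1)) * ‖x‖) ?_ ?_ ?_ ?_
    · simpa using (hpow.const_sub 1).mul_const ‖x‖
    · simpa using (hpow.const_add 1).mul_const ‖x‖
    all_goals
      filter_upwards [eventually_ge_atTop n] with m hm
      have := hf m (C.inclLE n m hm x)
      rw [LinearIsometry.norm_map] at this
      rw [ha hm]
    exacts [this.1, this.2]
  refine ⟨fun n => ⟨⟨⟨F n, hadd n⟩, hsmul n⟩, hnorm n⟩, fun n x => ?_, fun n x => ?_⟩
  · refine tendsto_nhds_unique (hF (n + 1) (C.incl n x)) ((hF n x).congr' ?_)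
    filter_upwards [eventually_ge_atTop (n + 1)] with m hm
    rw [ha hm, ha (n.le_succ.trans hm), C.inclLE_incl hm]
  · have h1 := dist_le_of_le_geometric_of_tendsto₀ _ _ (by norm_num) (hstep n x)
      ((tendsto_add_atTop_iff_nat n).2 (hF n x))
    rw [zero_add, ha le_rfl, inclLE_self, dist_eq_norm] at h1
    refine h1.trans_eq ?_
    ring

/-- If one of the players (Odd if `r = 0`, Eve if `r = 1`) absorbs a dense sequence of a Gurarii
space `G`, then the result of the play is `G`. -/
theorem IsGurarii.nonempty_result_equiv {G : Type u} [NormedAddCommGroup G] [NormedSpace 𝕜 G]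
    [CompleteSpace G] (hG : IsGurarii.{u} 𝕜 G) {v : ℕ → G} (hv : DenseRange v) (C : Chain.{u} 𝕜)
    {r : ℕ} (hr : r < 2)
    (hC : ∀ k, C.step (2 * k + r) = absorbingStrategy v _ (C.position (2 * k + r))) :
    Nonempty (C.Result ≃ₗᵢ[𝕜] G) := by
  have hf (n : ℕ) : IsAlmostIsometry ((1 / 2) ^ (n + 1)) (tracking v (C.position n)) := by
    have := hG.isAlmostIsometry_tracking v (C.position n)
    rwa [C.length_position] at this
  obtain ⟨F, hF, hFf⟩ := C.exists_limit_embeddings (fun n => tracking v (C.position n)) hf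
    fun n x => by
      have := (hG.isTracking_tracking v (C.position n) (C.step n)).2 x
      rwa [C.length_position] at this
  refine C.nonempty_result_equiv F hF fun z ε hε => ?_
  obtain ⟨i, hi⟩ := hv.exists_dist_lt z (half_pos hε)
  -- Each `v i` is absorbed at the turn `Nat.pair i q` for every `q`, hence arbitrarily late, when
  -- the tracking map is already close to its limit. The preimage has norm at most `2 * ‖v i‖`,
  -- whence the factor `4`.
  obtain ⟨q, hq⟩ := exists_pow_lt_of_lt_one
    (show 0 < ε / 2 / (4 * ‖v i‖ + 1) by positivity) (show (1 / 2 : ℝ) < 1 by norm_num)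
  let N := 2 * Nat.pair i q + r
  have hqN : q ≤ N + 1 := by
    have := Nat.right_le_pair i q
    omega
  have hN : v i ∈ LinearMap.range (tracking v (C.position (N + 1))) := by
    have := hG.mem_range_tracking v (C.position N) (hC (Nat.pair i q))
    rw [C.length_position, show N / 2 = Nat.pair i q by omega, Nat.unpair_pair] at this
    exact this
  obtain ⟨y, hy⟩ := hN
  refine ⟨N + 1, y, ?_⟩
  have h1 : ‖y‖ ≤ 2 * ‖v i‖ := by
    have h2 := (hf (N + 1) y).1
    rw [hy] at h2
    have h3 : (1 / 2 : ℝ) ^ (N + 1 + 1) ≤ 1 / 2 :=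
      pow_le_of_le_one (by norm_num) (by norm_num) (by omega)
    nlinarith [norm_nonneg y]
  have h4 : ‖v i - F (N + 1) y‖ < ε / 2 := by
    have h5 := hFf (N + 1) y
    rw [hy] at h5
    have h6 : (1 / 2 : ℝ) ^ (N + 1) ≤ (1 / 2) ^ q :=
      pow_le_pow_of_le_one (by norm_num) (by norm_num) hqN
    calc ‖v i - F (N + 1) y‖ ≤ 2 * (1 / 2) ^ (N + 1) * ‖y‖ := h5
      _ ≤ 2 * (1 / 2) ^ q * (2 * ‖v i‖) := by gcongr
      _ ≤ (1 / 2) ^ q * (4 * ‖v i‖ + 1) := by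
        have : (0 : ℝ) ≤ (1 / 2) ^ q := by positivity
        linarith
      _ < ε / 2 := (lt_div_iff₀ (by positivity)).1 hq
  rw [dist_eq_norm] at hi
  calc ‖z - F (N + 1) y‖ = ‖(z - v i) + (v i - F (N + 1) y)‖ := by rw [sub_add_sub_cancel]
    _ ≤ ‖z - v i‖ + ‖v i - F (N + 1) y‖ := norm_add_le _ _
    _ < ε := by linarith

theorem IsGurarii.oddHasStrategyLeadingTo {G : Type u} [NormedAddCommGroup G] [NormedSpace 𝕜 G]
    [CompleteSpace G] [TopologicalSpace.SeparableSpace G] (hG : IsGurarii.{u} 𝕜 G) :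
    OddHasStrategyLeadingTo.{u} 𝕜 G :=
  ⟨absorbingStrategy (TopologicalSpace.denseSeq G), fun C hC =>
    hG.nonempty_result_equiv (TopologicalSpace.denseRange_denseSeq G) C two_pos hC⟩

/-! ### Uniqueness: two strategies played against each other -/

/-- The successive positions of the play in which all moves follow the strategy `U`. -/
def Strategy.playPosition (U : Strategy.{u} 𝕜) : ℕ → Σ E : FinDimNormedSpace.{u} 𝕜, Position E
  | 0 => ⟨⟨PUnit⟩, .start _⟩
  | n + 1 => ⟨_, (U.playPosition n).2.move (U _ (U.playPosition n).2)⟩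

/-- The play in which all moves follow the strategy `U`. -/
def Strategy.play (U : Strategy.{u} 𝕜) : Chain.{u} 𝕜 where
  space n := (U.playPosition n).1
  incl n := (U _ (U.playPosition n).2).incl

theorem Strategy.position_play (U : Strategy.{u} 𝕜) (n : ℕ) :
    U.play.position n = (U.playPosition n).2 := by
  induction n with
  | zero => rfl
  | succ n ih => exact congrArg (fun p => Position.move p (U.play.step n)) ih

theorem Strategy.step_play (U : Strategy.{u} 𝕜) (n : ℕ) :
    U.play.step n = U _ (U.play.position n) := by
  rw [U.position_play]
  rfl

theorem IsGurarii.nonempty_equiv {G G' : Type u} [NormedAddCommGroup G] [NormedSpace 𝕜 G]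
    [CompleteSpace G] [TopologicalSpace.SeparableSpace G] (hG : IsGurarii.{u} 𝕜 G)
    [NormedAddCommGroup G'] [NormedSpace 𝕜 G'] (hG' : OddHasStrategyLeadingTo.{u} 𝕜 G') :
    Nonempty (G' ≃ₗᵢ[𝕜] G) := by
  obtain ⟨S, hS⟩ := hG'
  -- Odd moves from positions of even length and Eve from those of odd length, so one rule split by
  -- parity encodes both players. Eve's free first move is the trivial space.
  let U : Strategy.{u} 𝕜 := fun E p =>
    if Even p.length then S E p else absorbingStrategy (TopologicalSpace.denseSeq G) E p
  have hU (n : ℕ) : U.play.step n = if Even n then S _ (U.play.position n)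
      else absorbingStrategy (TopologicalSpace.denseSeq G) _ (U.play.position n) := by
    rw [U.step_play]
    simp only [U, Chain.length_position]
  obtain ⟨φ⟩ := hS U.play fun k => (hU _).trans (if_pos (by simp))
  obtain ⟨ψ⟩ := hG.nonempty_result_equiv (TopologicalSpace.denseRange_denseSeq G) U.play
    one_lt_two fun k => (hU _).trans (if_neg (by simp))
  exact ⟨φ.symm.trans ψ⟩

end BanachMazur

theorem theorem1p1 (𝕜 : Type) [RCLike 𝕜] :
    ∃ (G : Type u) (_ : NormedAddCommGroup G) (_ : NormedSpace 𝕜 G),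
      (CompleteSpace G ∧ TopologicalSpace.SeparableSpace G) ∧
      -- Odd has a strategy leading to `G`
      BanachMazur.OddHasStrategyLeadingTo.{u} 𝕜 G ∧
      -- `G` is unique with this property
      (∀ (G' : Type u) [NormedAddCommGroup G'] [NormedSpace 𝕜 G'] [CompleteSpace G']
        [TopologicalSpace.SeparableSpace G'],
        BanachMazur.OddHasStrategyLeadingTo.{u} 𝕜 G' → Nonempty (G' ≃ₗᵢ[𝕜] G)) ∧
      -- `G` is the Gurarii space, the unique separable Banach space with its extension property
      BanachMazur.IsGurarii.{u} 𝕜 G ∧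
      (∀ (G' : Type u) [NormedAddCommGroup G'] [NormedSpace 𝕜 G'] [CompleteSpace G']
        [TopologicalSpace.SeparableSpace G'],
        BanachMazur.IsGurarii.{u} 𝕜 G' → Nonempty (G' ≃ₗᵢ[𝕜] G)) := by
  obtain ⟨C, hC⟩ := BanachMazur.exists_rich_chain.{u} 𝕜
  have hG := C.isGurarii_result hC
  exact ⟨C.Result, inferInstance, inferInstance, ⟨inferInstance, inferInstance⟩,
    hG.oddHasStrategyLeadingTo, fun G' _ _ _ _ h => hG.nonempty_equiv h, hG,
    fun G' _ _ _ _ h => hG.nonempty_equiv h.oddHasStrategyLeadingTo⟩
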